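/- Let $q,\rho_1,\rho_2$ be real with $|q|,|\rho_1|,|\rho_2|<1$ and $\rho_1\neq 0$. Write $[n]_q=1+q+\dots+q^{n-1}$, $[n]_q!=\prod_{j=1}^n[j]_q$, $(a)_n=\prod_{j=0}^{n-1}(1-aq^j)$, $(a)_\infty=\prod_{j\ge 0}(1-aq^j)$, and $$S(q)=\Bigl[-\tfrac{2}{\sqrt{1-q}},\tfrac{2}{\sqrt{1-q}}\Bigr].$$ For real $y,\rho$ let $P_n(x|y,\rho,q)$ be the Al-Salam–Chihara polynomials defined by $P_{-1}=0$, $P_0=1$ and $$P_{n+1}(x|y,\rho,q)=(x-\rho yq^n)P_n(x|y,\rho,q)-(1-\rho^2q^{n-1})[n]_qP_{n-1}(x|y,\rho,q)\qquad(n\ge 0).$$ For $k\ge 0$ put $$W_k(x,y|t,q)=(1-t^2q^{2k})^2-(1-q)xytq^k(1+t^2q^{2k})+(1-q)t^2q^{2k}(x^2+y^2),$$ $$L_k(x|q)=(1+q^k)^2-(1-q)x^2q^k,$$ and, for $|\rho|<1$, $y\in S(q)$ and $x$ in the interior of $S(q)$, let $$f_{CN}(x|y,\rho,q)=\frac{\sqrt{1-q}\,(q)_\infty(\rho^2)_\infty}{2\pi\sqrt{L_0(x|q)}}\prod_{k=0}^\infty\frac{L_k(x|q)}{W_k(x,y|\rho,q)}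 .$$ Then for all $x,y,z\in S(q)$ the series and the product below converge (unconditionally) and $$0\le\sum_{n\ge 0}\frac{\rho_1^n}{[n]_q!\,(\rho_2^2)_n}P_n(x|y,\rho_2,q)\,P_n\Bigl(z\Big|y,\frac{\rho_2}{\rho_1},q\Bigr)=\frac{(\rho_1^2)_\infty}{(\rho_2^2)_\infty}\prod_{k=0}^\infty\frac{W_k(x,y|\rho_2,q)}{W_k(x,z|\rho_1,q)} .$$ If moreover $x$ is an interior point of $S(q)$, this sum equals $f_{CN}(x|z,\rho_1,q)/f_{CN}(x|y,\rho_2,q)$. -/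

import Mathlib

namespace QHermite

noncomputable section

/-- The `q`-number `[n]_q = 1 + q + ⋯ + q^(n-1)`. -/
def qNum (q : ℝ) (n : ℕ) : ℝ := ∑ j ∈ Finset.range n, q ^ j

/-- The `q`-factorial `[n]_q! = [1]_q [2]_q ⋯ [n]_q`. -/
def qFact (q : ℝ) (n : ℕ) : ℝ := ∏ j ∈ Finset.range n, qNum q (j + 1)

/-- The finite `q`-Pochhammer symbol `(a; q)_n = ∏_{j < n} (1 - a q^j)`. -/
def qPoch (a q : ℝ) (n : ℕ) : ℝ := ∏ j ∈ Finset.range n, (1 - a * q ^ j)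

/-- The infinite `q`-Pochhammer symbol `(a; q)_∞ = ∏_{j ≥ 0} (1 - a q^j)`, for `|q| < 1`. -/
def qPochInf (a q : ℝ) : ℝ := ∏' j : ℕ, (1 - a * q ^ j)

/-- The interval `S(q) = [-2/√(1-q), 2/√(1-q)]`, for `|q| < 1`. -/
def S (q : ℝ) : Set ℝ := Set.Icc (-(2 / √(1 - q))) (2 / √(1 - q))

/-- The auxiliary polynomials `W_k(x, y, t | q)`. -/
def W (k : ℕ) (x y t q : ℝ) : ℝ :=
  (1 - t ^ 2 * q ^ (2 * k)) ^ 2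
    - (1 - q) * x * y * t * q ^ k * (1 + t ^ 2 * q ^ (2 * k))
    + (1 - q) * t ^ 2 * q ^ (2 * k) * (x ^ 2 + y ^ 2)

/-- The auxiliary polynomials `L_k(x, 1 | q)`. -/
def L (k : ℕ) (x q : ℝ) : ℝ := (1 + q ^ k) ^ 2 - (1 - q) * x ^ 2 * q ^ k

/-- The Al-Salam–Chihara polynomials `P_n(x | y, ρ, q)` for arbitrary real `ρ`, given by
`P_{n+1} = (x - ρ y q^n) P_n - (1 - ρ² q^(n-1)) [n]_q P_{n-1}`, `P_{-1} = 0`, `P_0 = 1`. -/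
def P : ℕ → ℝ → ℝ → ℝ → ℝ → ℝ
  | 0, _, _, _, _ => 1
  | 1, x, y, ρ, _ => x - ρ * y
  | n + 2, x, y, ρ, q =>
      (x - ρ * y * q ^ (n + 1)) * P (n + 1) x y ρ q
        - (1 - ρ ^ 2 * q ^ n) * qNum q (n + 1) * P n x y ρ q

/-- The conditional `q`-normal density `f_CN(x | y, ρ, q)` for `|q| < 1`, with respect to which
the polynomials `P_n(· | y, ρ, q)`, `|ρ| < 1`, are orthogonal on `S(q)`. -/
def fCN (x y ρ q : ℝ) : ℝ :=
  √(1 - q) * qPochInf q q * qPochInf (ρ ^ 2) q / (2 * Real.pi * √(L 0 x q))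
    * ∏' k : ℕ, L k x q / W k x y ρ q

end

end QHermite

open Filter Topology

namespace QHermite

noncomputable section

/-! Let K_t(x,y) = ∑ t^i H_i(x) H_i(y) / [i]_q! be the Poisson–Mehler kernel. The sum in question is
K_{ρ₁}(x,z) / K_{ρ₂}(x,y).

Two identities give this. Raising the index of H(x) by n in K_{ρ₂}(x,y) multiplies the kernel by
P_n(x|y,ρ₂) / (ρ₂²)_n (`qPoch_mul_kernel`). The q-binomial convolution of ρ₁^n P_n(z|y,ρ₂/ρ₁) with
ρ₂^j H_j(y) is ρ₁^N H_N(z) (`sum_homP_mul_hermite`). Multiplying the latter by H_N(x) and summing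
over N expands K_{ρ₁}(x,z) in the shifted kernels (`hasSum_homP_mul_kernel`); absolute convergence
comes from growth bounds on the recurrences.

The product form follows from a functional equation relating K_t to K_{tq}, iterated down to K_0 = 1
(`kernel_eq_div`). The factors of the products are positive, hence so is the ratio. -/

/-- The continuous `q`-Hermite polynomials `H_n(x | q)`. -/
def hermite (q x : ℝ) : ℕ → ℝ
  | 0 => 1
  | 1 => x
  | n + 2 => x * hermite q x (n + 1) - qNum q (n + 1) * hermite q x n

/-- The homogenized Al-Salam–Chihara polynomials `ρ₁ ^ n * P_n(z | y, ρ₂ / ρ₁, q)`. -/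
def homP (q ρ₁ ρ₂ z y : ℝ) : ℕ → ℝ
  | 0 => 1
  | 1 => ρ₁ * z - ρ₂ * y
  | n + 2 => (ρ₁ * z - ρ₂ * y * q ^ (n + 1)) * homP q ρ₁ ρ₂ z y (n + 1)
      - (ρ₁ ^ 2 - ρ₂ ^ 2 * q ^ n) * qNum q (n + 1) * homP q ρ₁ ρ₂ z y n

end

/-! ### Homogenization and arithmetic of q-numbers -/

theorem pow_mul_P_div (q ρ₁ ρ₂ z y : ℝ) (h : ρ₁ ≠ 0) (n : ℕ) :
    ρ₁ ^ n * P n z y (ρ₂ / ρ₁) q = homP q ρ₁ ρ₂ z y n := by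
  induction n using Nat.twoStepInduction with
  | zero => simp [P, homP]
  | one => simp only [P, homP]; field_simp
  | more n h0 h1 =>
    rw [P, homP, ← h0, ← h1]
    field_simp
    ring

theorem qNum_succ (q : ℝ) (n : ℕ) : qNum q (n + 1) = 1 + q * qNum q n := by
  simp only [qNum, Finset.sum_range_succ', Finset.mul_sum, pow_succ']
  simp [add_comm]

theorem one_sub_mul_qNum (q : ℝ) (n : ℕ) : (1 - q) * qNum q n = 1 - q ^ n := by
  simpa [qNum] using mul_neg_geom_sum q n

theorem qNum_add (q : ℝ) (m i : ℕ) : qNum q (i + m) = qNum q m + q ^ m * qNum q i := by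
  rw [add_comm, qNum, Finset.sum_range_add]
  simp [qNum, Finset.mul_sum, pow_add]

theorem qNum_pos {q : ℝ} (hq : |q| < 1) (n : ℕ) : 0 < qNum q (n + 1) := by
  have h := one_sub_mul_qNum q (n + 1)
  have h1 : 0 < 1 - q := by linarith [(abs_lt.1 hq).2]
  have h2 : q ^ (n + 1) < 1 :=
    (le_abs_self _).trans_lt (by rw [abs_pow]; exact pow_lt_one₀ (abs_nonneg _) hq (by simp))
  by_contra! hc
  nlinarith

theorem qFact_pos {q : ℝ} (hq : |q| < 1) (n : ℕ) : 0 < qFact q n :=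
  Finset.prod_pos fun _ _ => qNum_pos hq _

theorem qFact_succ (q : ℝ) (n : ℕ) : qFact q (n + 1) = qFact q n * qNum q (n + 1) :=
  Finset.prod_range_succ _ _

theorem tendsto_qNum {q : ℝ} (hq : |q| < 1) : Tendsto (qNum q) atTop (𝓝 (1 - q)⁻¹) :=
  (hasSum_geometric_of_abs_lt_one hq).tendsto_sum_nat

/-! ### Growth of solutions of three-term recurrences -/

theorem exists_le_mul_pow_of_eventually {N : ℕ → ℝ} (hN : ∀ n, 0 ≤ N n) {r : ℝ} (hr : 0 < r)
    (h : ∀ᶠ n in atTop, N (n + 1) ≤ r * N n) : ∃ C, 0 < C ∧ ∀ n, N n ≤ C * r ^ n := by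
  obtain ⟨n₀, hn₀⟩ := eventually_atTop.1 h
  refine ⟨1 + ∑ k ∈ Finset.range (n₀ + 1), N k / r ^ k, ?_, fun n => ?_⟩
  · have : 0 ≤ ∑ k ∈ Finset.range (n₀ + 1), N k / r ^ k :=
      Finset.sum_nonneg fun k _ => div_nonneg (hN k) (by positivity)
    linarith
  · have key : ∀ k ≤ n₀, N k ≤ (1 + ∑ k ∈ Finset.range (n₀ + 1), N k / r ^ k) * r ^ k := by
      intro k hk
      have : N k / r ^ k ≤ ∑ k ∈ Finset.range (n₀ + 1), N k / r ^ k :=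
        Finset.single_le_sum (f := fun k => N k / r ^ k)
          (fun k _ => div_nonneg (hN k) (by positivity)) (by simp; omega)
      rw [← div_le_iff₀ (by positivity)]
      linarith
    rcases le_total n n₀ with hn | hn
    · exact key n hn
    · induction n, hn using Nat.le_induction with
      | base => exact key _ le_rfl
      | succ n hn ih =>
        calc N (n + 1) ≤ r * N n := hn₀ n hn
          _ ≤ r * ((1 + ∑ k ∈ Finset.range (n₀ + 1), N k / r ^ k) * r ^ n) := by gcongr
          _ = _ := by ring

/-- Solutions of a three-term recurrence whose limiting characteristic polynomial
`X² - A X + B` has non-real or double roots grow at most at the rate of any `r > √B`. -/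
theorem exists_abs_le_mul_pow {u a b : ℕ → ℝ} {A B r : ℝ}
    (hu : ∀ n, u (n + 2) = a n * u (n + 1) - b n * u n)
    (ha : Tendsto a atTop (𝓝 A)) (hb : Tendsto b atTop (𝓝 B)) (hAB : A ^ 2 ≤ 4 * B)
    (hr : √B < r) : ∃ C, 0 < C ∧ ∀ n, |u n| ≤ C * r ^ n := by
  have hB : 0 ≤ B := by nlinarith [sq_nonneg A]
  have hr0 : 0 < r := (Real.sqrt_nonneg B).trans_lt hr
  -- The roots of X² - A X + B: complex conjugate because A² ≤ 4B, so both have modulus √B.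
  set α : ℂ := ⟨A / 2, √(4 * B - A ^ 2) / 2⟩ with hα
  set β : ℂ := ⟨A / 2, -(√(4 * B - A ^ 2) / 2)⟩ with hβ
  have hs : √(4 * B - A ^ 2) * √(4 * B - A ^ 2) = 4 * B - A ^ 2 :=
    Real.mul_self_sqrt (by linarith)
  have hsum : α + β = A := by apply Complex.ext <;> simp [hα, hβ]
  have hprod : α * β = B := by
    apply Complex.ext <;> simp [hα, hβ]
    · nlinarith
    · ring
  have hnα : ‖α‖ = √B := by
    rw [Complex.norm_def, Complex.normSq_apply]; congr 1; simp only [hα]; nlinarith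
  have hnβ : ‖β‖ = √B := by
    rw [Complex.norm_def, Complex.normSq_apply]; congr 1; simp only [hβ]; nlinarith
  set σ := √B
  obtain ⟨r', hr'1, hr'2⟩ := exists_between hr
  have hd : 0 < r' - σ := by linarith
  -- This weight makes 1 + cσ = c r', so the unperturbed recurrence expands the norm `N` by at most
  -- r'.
  set c := (r' - σ)⁻¹ with hc
  have hc0 : 0 < c := inv_pos.2 hd
  have hcd : c * (r' - σ) = 1 := inv_mul_cancel₀ hd.ne'
  -- Factoring by α splits the recurrence into two first-order ones, with multipliers α and β; `e`
  -- collects the error from a n ≠ A and b n ≠ B.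
  set v : ℕ → ℂ := fun n => u (n + 1) - α * u n with hv
  set N : ℕ → ℝ := fun n => ‖(u n : ℂ)‖ + c * ‖v n‖ with hN
  set e : ℕ → ℝ := fun n => c * ((|a n - A| * (σ + c⁻¹)) + |b n - B|) with he
  have hu1 : ∀ n, ‖(u (n + 1) : ℂ)‖ ≤ σ * ‖(u n : ℂ)‖ + ‖v n‖ := by
    intro n
    have : (u (n + 1) : ℂ) = α * u n + v n := by simp [hv]
    rw [this, ← hnα, ← norm_mul]
    exact norm_add_le _ _
  have hv1 : ∀ n, ‖v (n + 1)‖ ≤ σ * ‖v n‖ + |a n - A| * ‖(u (n + 1) : ℂ)‖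
      + |b n - B| * ‖(u n : ℂ)‖ := by
    intro n
    have : v (n + 1) = β * v n + ((a n - A : ℝ) : ℂ) * u (n + 1)
        + (-(b n - B : ℝ) : ℂ) * u n := by
      simp only [hv, hu]
      push_cast
      linear_combination (u (n + 1) : ℂ) * (-hsum) + (u n : ℂ) * hprod
    rw [this]
    refine (norm_add₃_le).trans (le_of_eq ?_)
    rw [norm_mul, norm_mul, norm_mul, hnβ, norm_neg]
    simp only [Complex.norm_real, Real.norm_eq_abs]
  have hstep : ∀ n, N (n + 1) ≤ (r' + e n) * N n := by
    intro n
    have h1 := hu1 n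
    have h2 := hv1 n
    have hx := norm_nonneg (u n : ℂ)
    have hy := norm_nonneg (v n)
    have hσ : 0 ≤ σ := Real.sqrt_nonneg B
    have h3 : ‖(u (n + 1) : ℂ)‖ ≤ (σ + c⁻¹) * N n := by
      have : (σ + c⁻¹) * N n = σ * ‖(u n : ℂ)‖ + ‖v n‖ + (σ * c * ‖v n‖ + c⁻¹ * ‖(u n : ℂ)‖) := by
        simp only [hN]; field_simp; ring
      rw [this]
      have : 0 ≤ σ * c * ‖v n‖ + c⁻¹ * ‖(u n : ℂ)‖ := by positivity
      linarith
    have h4 : ‖(u n : ℂ)‖ ≤ N n := by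
      simp only [hN]; nlinarith
    have h5 : |a n - A| * ‖(u (n + 1) : ℂ)‖ ≤ |a n - A| * ((σ + c⁻¹) * N n) := by gcongr
    have h6 : |b n - B| * ‖(u n : ℂ)‖ ≤ |b n - B| * N n := by gcongr
    have h7 : σ * ‖(u n : ℂ)‖ + ‖v n‖ + c * (σ * ‖v n‖) ≤ r' * N n := by
      have : r' * N n = r' * ‖(u n : ℂ)‖ + (c * (r' - σ)) * ‖v n‖ + c * (σ * ‖v n‖) := by
        simp only [hN]; ring
      rw [this, hcd]; nlinarith
    calc N (n + 1) = ‖(u (n + 1) : ℂ)‖ + c * ‖v (n + 1)‖ := rfl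
      _ ≤ (σ * ‖(u n : ℂ)‖ + ‖v n‖) + c * (σ * ‖v n‖ + |a n - A| * ((σ + c⁻¹) * N n)
          + |b n - B| * N n) := by gcongr; linarith
      _ ≤ r' * N n + c * (|a n - A| * ((σ + c⁻¹) * N n) + |b n - B| * N n) := by linarith
      _ = (r' + e n) * N n := by simp only [he]; ring
  have he0 : Tendsto e atTop (𝓝 0) := by
    have h1 : Tendsto (fun n => |a n - A|) atTop (𝓝 0) := by
      simpa using (ha.sub_const A).abs
    have h2 : Tendsto (fun n => |b n - B|) atTop (𝓝 0) := by
      simpa using (hb.sub_const B).abs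
    simpa using ((h1.mul_const (σ + c⁻¹)).add h2).const_mul c
  have hN0 : ∀ n, 0 ≤ N n := fun n => by positivity
  obtain ⟨C, hC, hCN⟩ := exists_le_mul_pow_of_eventually hN0 hr0 (by
    filter_upwards [he0.eventually (gt_mem_nhds (sub_pos.2 hr'2))] with n hn
    refine (hstep n).trans ?_
    exact mul_le_mul_of_nonneg_right (by linarith) (hN0 n))
  refine ⟨C, hC, fun n => le_trans ?_ (hCN n)⟩
  have : 0 ≤ c * ‖v n‖ := by positivity
  simp only [hN, Complex.norm_real, Real.norm_eq_abs]
  linarith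

/-! ### Growth rates on S(q) and absolute convergence -/

theorem exists_inv_qFact_le {q : ℝ} (hq : |q| < 1) {r : ℝ} (hr : 1 - q < r) :
    ∃ C, 0 < C ∧ ∀ n, (qFact q n)⁻¹ ≤ C * r ^ n := by
  have h1 : 0 < 1 - q := by linarith [(abs_lt.1 hq).2]
  refine exists_le_mul_pow_of_eventually (fun n => (inv_pos.2 (qFact_pos hq n)).le)
    (h1.trans hr) ?_
  have ht : Tendsto (fun n => (qNum q (n + 1))⁻¹) atTop (𝓝 (1 - q)) := by
    simpa using ((tendsto_qNum hq).comp (tendsto_add_atTop_nat 1)).inv₀ (inv_ne_zero h1.ne')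
  filter_upwards [ht.eventually (gt_mem_nhds hr)] with n hn
  rw [qFact_succ, mul_inv, mul_comm]
  have := inv_pos.2 (qFact_pos hq n)
  gcongr

theorem mem_S_iff_sq {q x : ℝ} (hq : q < 1) : x ∈ S q ↔ x ^ 2 * (1 - q) ≤ 4 := by
  have h1 : 0 < 1 - q := by linarith
  have hs := Real.sqrt_pos.2 h1
  rw [S, Set.mem_Icc, ← abs_le, le_div_iff₀ hs, ← abs_of_pos hs, ← abs_mul,
    ← abs_of_pos (two_pos (α := ℝ)), ← sq_le_sq, mul_pow, Real.sq_sqrt h1.le]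
  norm_num

/-- The limiting recurrence has A = x and B = 1/(1-q), and x ∈ S(q) says exactly that A² ≤ 4B. -/
theorem exists_hermite_le {q x r : ℝ} (hq : |q| < 1) (hx : x ∈ S q) (hr : √(1 - q)⁻¹ < r) :
    ∃ C, 0 < C ∧ ∀ n, |hermite q x n| ≤ C * r ^ n := by
  have h1 : 0 < 1 - q := by linarith [(abs_lt.1 hq).2]
  rw [mem_S_iff_sq (by linarith)] at hx
  refine exists_abs_le_mul_pow (a := fun _ => x) (b := fun n => qNum q (n + 1)) (fun n => rfl)
    tendsto_const_nhds ((tendsto_qNum hq).comp (tendsto_add_atTop_nat 1)) ?_ hr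
  rwa [← div_eq_mul_inv, le_div_iff₀ h1]

/-- In the limit the terms with ρ₂ die out, leaving the Hermite recurrence in z rescaled by ρ₁. -/
theorem exists_homP_le {q ρ₁ ρ₂ z y r : ℝ} (hq : |q| < 1) (hz : z ∈ S q)
    (hr : |ρ₁| * √(1 - q)⁻¹ < r) :
    ∃ C, 0 < C ∧ ∀ n, |homP q ρ₁ ρ₂ z y n| ≤ C * r ^ n := by
  have h1 : 0 < 1 - q := by linarith [(abs_lt.1 hq).2]
  rw [mem_S_iff_sq (by linarith)] at hz
  have hpow := tendsto_pow_atTop_nhds_zero_of_abs_lt_one hq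
  refine exists_abs_le_mul_pow (a := fun n => ρ₁ * z - ρ₂ * y * q ^ (n + 1))
    (b := fun n => (ρ₁ ^ 2 - ρ₂ ^ 2 * q ^ n) * qNum q (n + 1))
    (A := ρ₁ * z) (B := ρ₁ ^ 2 * (1 - q)⁻¹) (fun n => rfl) ?_ ?_ ?_ ?_
  · simpa using ((hpow.comp (tendsto_add_atTop_nat 1)).const_mul (ρ₂ * y)).const_sub (ρ₁ * z)
  · simpa using ((hpow.const_mul (ρ₂ ^ 2)).const_sub (ρ₁ ^ 2)).mul
      ((tendsto_qNum hq).comp (tendsto_add_atTop_nat 1))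
  · have : z ^ 2 ≤ 4 * (1 - q)⁻¹ := by rwa [← div_eq_mul_inv, le_div_iff₀ h1]
    nlinarith [sq_nonneg ρ₁]
  · rwa [Real.sqrt_mul (sq_nonneg _), Real.sqrt_sq_eq_abs]

/-- Each term of the series is bounded through three growth estimates per index, each losing a
factor κ; hence the cube. -/
theorem exists_one_lt_pow_mul_lt {ρ σ : ℝ} (hρ : |ρ| < 1) (hσ : |σ| < 1) :
    ∃ κ : ℝ, 1 < κ ∧ κ ^ 3 * |ρ| < 1 ∧ κ ^ 3 * |σ| < 1 := by
  have h (ρ : ℝ) (hρ : |ρ| < 1) : ∀ᶠ κ : ℝ in 𝓝[>] 1, κ ^ 3 * |ρ| < 1 := by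
    have : Tendsto (fun κ : ℝ => κ ^ 3 * |ρ|) (𝓝[>] 1) (𝓝 (1 ^ 3 * |ρ|)) :=
      ((continuous_pow 3).mul_const _).continuousAt.mono_left nhdsWithin_le_nhds
    exact this.eventually (gt_mem_nhds (by simpa using hρ))
  obtain ⟨κ, h1, h2, h3⟩ := ((h ρ hρ).and ((h σ hσ).and self_mem_nhdsWithin)).exists
  exact ⟨κ, h3, h1, h2⟩

/-- Joint bound for the double series whose two iterated sums are compared in
`hasSum_homP_mul_kernel`. -/
theorem summable_double {q ρ₁ ρ₂ x y z : ℝ} (hq : |q| < 1) (hρ₁ : |ρ₁| < 1) (hρ₁' : ρ₁ ≠ 0)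
    (hρ₂ : |ρ₂| < 1) (hx : x ∈ S q) (hy : y ∈ S q) (hz : z ∈ S q) :
    Summable fun p : ℕ × ℕ => homP q ρ₁ ρ₂ z y p.1 / qFact q p.1 *
      (ρ₂ ^ p.2 / qFact q p.2 * hermite q x (p.2 + p.1) * hermite q y p.2) := by
  have h1 : 0 < 1 - q := by linarith [(abs_lt.1 hq).2]
  obtain ⟨κ, hκ, hκ1, hκ2⟩ := exists_one_lt_pow_mul_lt hρ₁ hρ₂
  set w := √(1 - q)⁻¹ with hw
  have hw0 : 0 < w := Real.sqrt_pos.2 (inv_pos.2 h1)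
  have hw2 : (1 - q) * w ^ 2 = 1 := by
    rw [hw, Real.sq_sqrt (inv_pos.2 h1).le, mul_inv_cancel₀ h1.ne']
  have hκw : w < κ * w := by nlinarith
  obtain ⟨A, hA, hHx⟩ := exists_hermite_le hq hx hκw
  obtain ⟨B, hB, hHy⟩ := exists_hermite_le hq hy hκw
  obtain ⟨D, hD, hF⟩ := exists_inv_qFact_le hq (r := κ * (1 - q)) (by nlinarith)
  obtain ⟨E, hE, hQ⟩ := exists_homP_le (ρ₁ := ρ₁) (ρ₂ := ρ₂) (y := y) (r := κ * (|ρ₁| * w)) hq hz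
    (by have := mul_pos (abs_pos.2 hρ₁') hw0; nlinarith)
  have hκ0 : 0 < κ := by linarith
  have hs := ((summable_geometric_of_lt_one (by positivity) hκ1).mul_of_nonneg
    (summable_geometric_of_lt_one (by positivity) hκ2) (fun _ => by positivity)
    (fun _ => by positivity)).mul_left (E * D * (D * A * B))
  refine Summable.of_norm_bounded hs ?_
  rintro ⟨n, i⟩
  have hn := qFact_pos hq n
  have hi := qFact_pos hq i
  simp only [Real.norm_eq_abs, abs_mul, abs_div, abs_pow, abs_of_pos hn, abs_of_pos hi]
  calc |homP q ρ₁ ρ₂ z y n| / qFact q n *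
        (|ρ₂| ^ i / qFact q i * |hermite q x (i + n)| * |hermite q y i|)
      = |homP q ρ₁ ρ₂ z y n| * (qFact q n)⁻¹ *
        (|ρ₂| ^ i * (qFact q i)⁻¹ * |hermite q x (i + n)| * |hermite q y i|) := by
        simp only [div_eq_mul_inv]
    _ ≤ (E * (κ * (|ρ₁| * w)) ^ n) * (D * (κ * (1 - q)) ^ n) *
        (|ρ₂| ^ i * (D * (κ * (1 - q)) ^ i) * (A * (κ * w) ^ (i + n)) * (B * (κ * w) ^ i)) := by
        have := inv_pos.2 hn
        have := inv_pos.2 hi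
        gcongr
        exacts [hQ n, hF n, hF i, hHx _, hHy i]
    _ = E * D * (D * A * B) * ((κ ^ 3 * |ρ₁| * ((1 - q) * w ^ 2)) ^ n *
        (κ ^ 3 * |ρ₂| * ((1 - q) * w ^ 2)) ^ i) := by
        simp only [mul_pow, pow_add]; ring
    _ = _ := by rw [hw2, mul_one, mul_one]

theorem summable_hermite_mul_hermite {q ρ x y : ℝ} (hq : |q| < 1) (hρ : |ρ| < 1)
    (hx : x ∈ S q) (hy : y ∈ S q) (m k : ℕ) :
    Summable fun i : ℕ => ρ ^ i / qFact q i * hermite q x (i + m) * hermite q y (i + k) := by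
  have h1 : 0 < 1 - q := by linarith [(abs_lt.1 hq).2]
  obtain ⟨κ, hκ, -, hκ2⟩ := exists_one_lt_pow_mul_lt hρ hρ
  set w := √(1 - q)⁻¹ with hw
  have hw0 : 0 < w := Real.sqrt_pos.2 (inv_pos.2 h1)
  have hw2 : (1 - q) * w ^ 2 = 1 := by
    rw [hw, Real.sq_sqrt (inv_pos.2 h1).le, mul_inv_cancel₀ h1.ne']
  have hκw : w < κ * w := by nlinarith
  obtain ⟨A, hA, hHx⟩ := exists_hermite_le hq hx hκw
  obtain ⟨B, hB, hHy⟩ := exists_hermite_le hq hy hκw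
  obtain ⟨D, hD, hF⟩ := exists_inv_qFact_le hq (r := κ * (1 - q)) (by nlinarith)
  have hκ0 : 0 < κ := by linarith
  refine Summable.of_norm_bounded ((summable_geometric_of_lt_one (by positivity) hκ2).mul_left
    (D * (A * (κ * w) ^ m) * (B * (κ * w) ^ k))) fun i => ?_
  have hi := qFact_pos hq i
  simp only [Real.norm_eq_abs, abs_mul, abs_div, abs_pow, abs_of_pos hi]
  rw [div_eq_mul_inv]
  calc |ρ| ^ i * (qFact q i)⁻¹ * |hermite q x (i + m)| * |hermite q y (i + k)|
      ≤ |ρ| ^ i * (D * (κ * (1 - q)) ^ i) * (A * (κ * w) ^ (i + m)) *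
        (B * (κ * w) ^ (i + k)) := by
        have := inv_pos.2 hi
        gcongr
        exacts [hF i, hHx _, hHy _]
    _ = D * (A * (κ * w) ^ m) * (B * (κ * w) ^ k) *
        (κ ^ 3 * |ρ| * ((1 - q) * w ^ 2)) ^ i := by
        simp only [mul_pow, pow_add]; ring
    _ = _ := by rw [hw2, mul_one]

/-! ### Shifted kernels and the Al-Salam–Chihara recurrence -/

/-- The shifted Poisson–Mehler kernel `∑ ρ^i / [i]_q! H_{i+m}(x) H_{i+k}(y)`. -/
noncomputable def kernel (q ρ x y : ℝ) (m k : ℕ) : ℝ :=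
  ∑' i : ℕ, ρ ^ i / qFact q i * hermite q x (i + m) * hermite q y (i + k)

theorem hermite_recurrence (q x : ℝ) (n : ℕ) :
    x * hermite q x n = hermite q x (n + 1) + qNum q n * hermite q x (n - 1) := by
  cases n with
  | zero => simp [hermite, qNum]
  | succ n => simp [hermite]

theorem qNum_zero (q : ℝ) : qNum q 0 = 0 := by simp [qNum]

theorem kernel_comm (q ρ x y : ℝ) (m k : ℕ) : kernel q ρ x y m k = kernel q ρ y x k m :=
  tsum_congr fun _ => by ring

/-- Expand x H_{i+m} by its recurrence and split [i+m] = [m] + q^m [i]. The [i] cancels against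
[i]!, and reindexing i turns that part into a factor ρ and a shift of k. -/
theorem mul_kernel {q ρ x y : ℝ} (hq : |q| < 1) (hρ : |ρ| < 1)
    (hx : x ∈ S q) (hy : y ∈ S q) (m k : ℕ) :
    x * kernel q ρ x y m k = kernel q ρ x y (m + 1) k + qNum q m * kernel q ρ x y (m - 1) k
      + q ^ m * ρ * kernel q ρ x y m (k + 1) := by
  have h0 := (summable_hermite_mul_hermite hq hρ hx hy m k).hasSum.mul_left x
  have h1 := (summable_hermite_mul_hermite hq hρ hx hy (m + 1) k).hasSum
  have h2 := (summable_hermite_mul_hermite hq hρ hx hy (m - 1) k).hasSum.mul_left (qNum q m)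
  have h3 : HasSum (fun i => q ^ m * qNum q i *
      (ρ ^ i / qFact q i * hermite q x (i + m - 1) * hermite q y (i + k)))
      (q ^ m * ρ * kernel q ρ x y m (k + 1)) := by
    rw [← hasSum_nat_add_iff' 1]
    simp only [Finset.range_one, Finset.sum_singleton, qNum_zero, mul_zero, zero_mul, sub_zero]
    refine ((summable_hermite_mul_hermite hq hρ hx hy m (k + 1)).hasSum.mul_left
      (q ^ m * ρ)).congr_fun fun i => ?_
    have e1 : i + 1 + m - 1 = i + m := by omega
    have e2 : i + 1 + k = i + (k + 1) := by omega
    have := (qNum_pos hq i).ne'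
    have := (qFact_pos hq i).ne'
    rw [e1, e2, qFact_succ]
    field_simp
    ring
  refine h0.unique (((h1.add h2).add h3).congr_fun fun i => ?_)
  have hr := hermite_recurrence q x (i + m)
  rw [qNum_add] at hr
  -- The two truncated subtractions differ only when m = 0, where [0] = 0.
  have hm : qNum q m * hermite q x (i + m - 1) = qNum q m * hermite q x (i + (m - 1)) := by
    cases m with
    | zero => simp [qNum_zero]
    | succ m => rfl
  linear_combination ρ ^ i / qFact q i * hermite q y (i + k) * (hr + hm)

/-- The mixed kernel with shifts (m, 1) is eliminated using the analogous relation for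
multiplication by y. -/
theorem kernel_succ {q ρ x y : ℝ} (hq : |q| < 1) (hρ : |ρ| < 1)
    (hx : x ∈ S q) (hy : y ∈ S q) (m : ℕ) :
    (1 - ρ ^ 2 * q ^ m) * kernel q ρ x y (m + 1) 0 =
      (x - ρ * y * q ^ m) * kernel q ρ x y m 0 - qNum q m * kernel q ρ x y (m - 1) 0 := by
  have h1 := mul_kernel hq hρ hx hy m 0
  have h2 := mul_kernel hq hρ hy hx 0 m
  simp only [← kernel_comm q ρ x y, qNum_zero] at h2
  linear_combination -h1 + ρ * q ^ m * h2

theorem qPoch_succ (a q : ℝ) (n : ℕ) : qPoch a q (n + 1) = qPoch a q n * (1 - a * q ^ n) :=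
  Finset.prod_range_succ _ _

theorem qPoch_mul_kernel {q ρ x y : ℝ} (hq : |q| < 1) (hρ : |ρ| < 1)
    (hx : x ∈ S q) (hy : y ∈ S q) (m : ℕ) :
    qPoch (ρ ^ 2) q m * kernel q ρ x y m 0 = P m x y ρ q * kernel q ρ x y 0 0 := by
  induction m using Nat.twoStepInduction with
  | zero => simp [qPoch, P]
  | one =>
    have := kernel_succ hq hρ hx hy 0
    simp only [qNum_zero] at this
    rw [qPoch_succ]
    simp only [qPoch, P, Finset.range_zero, Finset.prod_empty]
    linear_combination this
  | more m h0 h1 =>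
    have := kernel_succ hq hρ hx hy (m + 1)
    rw [Nat.add_sub_cancel] at this
    rw [qPoch_succ, P]
    rw [qPoch_succ] at h1 ⊢
    linear_combination qPoch (ρ ^ 2) q m * (1 - ρ ^ 2 * q ^ m) * this
      + (x - ρ * y * q ^ (m + 1)) * h1 - (1 - ρ ^ 2 * q ^ m) * qNum q (m + 1) * h0

/-! ### Connection between the Al-Salam–Chihara and the `q`-Hermite polynomials -/

open Finset in
/-- The `q`-Leibniz rule for the `q`-derivative of a Cauchy product. -/
theorem qNum_mul_sum_antidiagonal (q : ℝ) (c d : ℕ → ℝ) (N : ℕ) :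
    qNum q (N + 1) * ∑ p ∈ antidiagonal (N + 1), c p.1 * d p.2 =
      ∑ p ∈ antidiagonal N, (qNum q (p.1 + 1) * c (p.1 + 1)) * d p.2
        + ∑ p ∈ antidiagonal N, q ^ p.1 * c p.1 * (qNum q (p.2 + 1) * d (p.2 + 1)) := by
  have h1 : qNum q (N + 1) * ∑ p ∈ antidiagonal (N + 1), c p.1 * d p.2 =
      ∑ p ∈ antidiagonal (N + 1), qNum q p.1 * c p.1 * d p.2
        + ∑ p ∈ antidiagonal (N + 1), q ^ p.1 * c p.1 * (qNum q p.2 * d p.2) := by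
    rw [← sum_add_distrib, mul_sum]
    refine sum_congr rfl fun p hp => ?_
    rw [← mem_antidiagonal.1 hp, add_comm p.1, qNum_add]
    ring
  rw [h1, Finset.Nat.sum_antidiagonal_succ, Finset.Nat.sum_antidiagonal_succ']
  simp [qNum_zero]

open Finset in
-- By the q-Leibniz rule the convolution satisfies a three-term recurrence in N; the contributions
-- of ρ₂y and ρ₂² from the two factors cancel, leaving that of ρ₁^N H_N(z) / [N]!.
theorem sum_homP_mul_hermite {q : ℝ} (hq : |q| < 1) (ρ₁ ρ₂ z y : ℝ) (N : ℕ) :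
    ∑ p ∈ antidiagonal N, homP q ρ₁ ρ₂ z y p.1 / qFact q p.1 *
      (ρ₂ ^ p.2 * hermite q y p.2 / qFact q p.2) = ρ₁ ^ N * hermite q z N / qFact q N := by
  set c : ℕ → ℝ := fun n => homP q ρ₁ ρ₂ z y n / qFact q n with hc
  set d : ℕ → ℝ := fun n => ρ₂ ^ n * hermite q y n / qFact q n with hd
  have hF n := (qFact_pos hq n).ne'
  have hn n := (qNum_pos hq n).ne'
  have c1 : qNum q 1 * c 1 = (ρ₁ * z - ρ₂ * y) * c 0 := by
    simp [hc, homP, qFact, qNum]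
  have c2 (n : ℕ) : qNum q (n + 2) * c (n + 2) = (ρ₁ * z - ρ₂ * y * q ^ (n + 1)) * c (n + 1)
      - (ρ₁ ^ 2 - ρ₂ ^ 2 * q ^ n) * c n := by
    have := hF n
    have := hn n
    have := hn (n + 1)
    simp only [hc, qFact_succ, homP]
    field_simp
  have d1 : qNum q 1 * d 1 = ρ₂ * y * d 0 := by
    simp [hd, hermite, qFact, qNum]
  have d2 (n : ℕ) : qNum q (n + 2) * d (n + 2) = ρ₂ * y * d (n + 1) - ρ₂ ^ 2 * d n := by
    have := hF n
    have := hn n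
    have := hn (n + 1)
    simp only [hd, qFact_succ, hermite]
    field_simp
    ring
  change ∑ p ∈ antidiagonal N, c p.1 * d p.2 = _
  induction N using Nat.twoStepInduction with
  | zero => simp [hc, hd, homP, hermite, qFact]
  | one =>
    have := qNum_mul_sum_antidiagonal q c d 0
    simp only [Finset.Nat.antidiagonal_zero, sum_singleton, zero_add, c1, d1] at this
    apply mul_left_cancel₀ (hn 0)
    rw [zero_add, this]
    simp [hc, hd, homP, hermite, qFact, qNum]
  | more N h0 h1 =>
    apply mul_left_cancel₀ (hn (N + 1))
    have e := qNum_mul_sum_antidiagonal q c d (N + 1)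
    have e1 : ∑ p ∈ antidiagonal (N + 1), (qNum q (p.1 + 1) * c (p.1 + 1)) * d p.2 =
        ∑ p ∈ antidiagonal (N + 1), (ρ₁ * z - ρ₂ * y * q ^ p.1) * c p.1 * d p.2
        - ∑ p ∈ antidiagonal N, (ρ₁ ^ 2 - ρ₂ ^ 2 * q ^ p.1) * c p.1 * d p.2 := by
      rw [Finset.Nat.sum_antidiagonal_succ, Finset.Nat.sum_antidiagonal_succ]
      simp only [zero_add, c1, c2, sub_mul, sum_sub_distrib, pow_zero, mul_one]
      ring
    have e2 : ∑ p ∈ antidiagonal (N + 1), q ^ p.1 * c p.1 * (qNum q (p.2 + 1) * d (p.2 + 1)) =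
        ∑ p ∈ antidiagonal (N + 1), q ^ p.1 * c p.1 * (ρ₂ * y * d p.2)
        - ∑ p ∈ antidiagonal N, q ^ p.1 * c p.1 * (ρ₂ ^ 2 * d p.2) := by
      rw [Finset.Nat.sum_antidiagonal_succ', Finset.Nat.sum_antidiagonal_succ']
      simp only [zero_add, d1, d2, mul_sub, sum_sub_distrib]
      ring
    have e3 : ∑ p ∈ antidiagonal (N + 1), (ρ₁ * z - ρ₂ * y * q ^ p.1) * c p.1 * d p.2
        + ∑ p ∈ antidiagonal (N + 1), q ^ p.1 * c p.1 * (ρ₂ * y * d p.2)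
        = ρ₁ * z * ∑ p ∈ antidiagonal (N + 1), c p.1 * d p.2 := by
      rw [← sum_add_distrib, mul_sum]
      exact sum_congr rfl fun p _ => by ring
    have e4 : ∑ p ∈ antidiagonal N, (ρ₁ ^ 2 - ρ₂ ^ 2 * q ^ p.1) * c p.1 * d p.2
        + ∑ p ∈ antidiagonal N, q ^ p.1 * c p.1 * (ρ₂ ^ 2 * d p.2)
        = ρ₁ ^ 2 * ∑ p ∈ antidiagonal N, c p.1 * d p.2 := by
      rw [← sum_add_distrib, mul_sum]
      exact sum_congr rfl fun p _ => by ring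
    rw [h1] at e3
    rw [h0] at e4
    have e5 : qNum q (N + 1 + 1) * (ρ₁ ^ (N + 2) * hermite q z (N + 2) / qFact q (N + 2)) =
        ρ₁ * z * (ρ₁ ^ (N + 1) * hermite q z (N + 1) / qFact q (N + 1))
        - ρ₁ ^ 2 * (ρ₁ ^ N * hermite q z N / qFact q N) := by
      have := hF N
      have := hn N
      have := hn (N + 1)
      simp only [qFact_succ, hermite]
      field_simp
      ring
    linear_combination e + e1 + e2 + e3 - e4 - e5

open Finset in
-- The double series is summed by rows, giving shifted kernels, and along antidiagonals n + i = N,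
-- where H_{n+i}(x) is constant and the convolution identity applies.
theorem hasSum_homP_mul_kernel {q ρ₁ ρ₂ x y z : ℝ} (hq : |q| < 1) (hρ₁ : |ρ₁| < 1)
    (hρ₁' : ρ₁ ≠ 0) (hρ₂ : |ρ₂| < 1) (hx : x ∈ S q) (hy : y ∈ S q) (hz : z ∈ S q) :
    HasSum (fun n => homP q ρ₁ ρ₂ z y n / qFact q n * kernel q ρ₂ x y n 0)
      (kernel q ρ₁ x z 0 0) := by
  have hs := summable_double hq hρ₁ hρ₁' hρ₂ hx hy hz
  have hrow := hs.hasSum.prod_fiberwise fun n =>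
    ((summable_hermite_mul_hermite hq hρ₂ hx hy n 0).hasSum.mul_left
      (homP q ρ₁ ρ₂ z y n / qFact q n))
  have hdiag := (HasAntidiagonal.sigmaAntidiagonalEquivProd.hasSum_iff.2 hs.hasSum).sigma
    fun N => hasSum_fintype _
  have : kernel q ρ₁ x z 0 0 = ∑' p : ℕ × ℕ, homP q ρ₁ ρ₂ z y p.1 / qFact q p.1 *
      (ρ₂ ^ p.2 / qFact q p.2 * hermite q x (p.2 + p.1) * hermite q y p.2) := by
    refine (summable_hermite_mul_hermite hq hρ₁ hx hz 0 0).hasSum.unique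
      (hdiag.congr_fun fun N => ?_)
    rw [Finset.univ_eq_attach]
    have h := sum_homP_mul_hermite hq ρ₁ ρ₂ z y N
    trans hermite q x N * (ρ₁ ^ N * hermite q z N / qFact q N)
    · simp only [add_zero]; ring
    · rw [← h, mul_sum, ← sum_attach]
      refine sum_congr rfl fun p _ => ?_
      have hp := mem_antidiagonal.1 p.2
      simp only [Function.comp, HasAntidiagonal.sigmaAntidiagonalEquivProd_apply]
      rw [add_comm p.1.2, hp]
      ring
  rw [this]
  exact hrow

/-! ### The Poisson–Mehler formula -/

theorem kernel_eq_tsum (q t x y : ℝ) :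
    kernel q t x y 0 0 = ∑' i, hermite q x i * hermite q y i / qFact q i * t ^ i :=
  tsum_congr fun i => by simp only [add_zero]; ring

theorem summable_kernel {q t x y : ℝ} (hq : |q| < 1) (ht : |t| < 1)
    (hx : x ∈ S q) (hy : y ∈ S q) :
    Summable fun i => hermite q x i * hermite q y i / qFact q i * t ^ i :=
  (summable_hermite_mul_hermite hq ht hx hy 0 0).congr fun i => by
    simp only [add_zero]; ring

/-- The left coefficients are those of W_0 as a polynomial in t; the powers of q on the right turn t
into tq in the generating function. -/
theorem hermite_product_recurrence {q : ℝ} (hq : |q| < 1) (x y : ℝ) (c : ℕ → ℝ)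
    (hc : ∀ n, c n = hermite q x n * hermite q y n / qFact q n) (n : ℕ) :
    c (n + 4) - (1 - q) * x * y * c (n + 3) + (-2 + (1 - q) * (x ^ 2 + y ^ 2)) * c (n + 2)
      - (1 - q) * x * y * c (n + 1) + c n
    = q ^ (n + 4) * c (n + 4) - (1 + q) * q ^ (n + 2) * c (n + 2) + q ^ (n + 1) * c n := by
  have e1 : q ^ (n + 1) = 1 - (1 - q) * qNum q (n + 1) := by
    rw [one_sub_mul_qNum]; ring
  have e2 : q ^ (n + 2) = q * (1 - (1 - q) * qNum q (n + 1)) := by rw [← e1]; ring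
  have e4 : q ^ (n + 4) = q ^ 3 * (1 - (1 - q) * qNum q (n + 1)) := by rw [← e1]; ring
  -- Used to bring all terms over the common denominator [n+4]!.
  have hinv (k : ℕ) : (qFact q k)⁻¹ = qNum q (k + 1) * (qFact q (k + 1))⁻¹ := by
    rw [qFact_succ, mul_inv, mul_left_comm, mul_inv_cancel₀ (qNum_pos hq k).ne', mul_one]
  have i0 := hinv n
  have i1 := hinv (n + 1)
  have i2 := hinv (n + 2)
  have i3 := hinv (n + 3)
  have r2 := qNum_succ q (n + 1)
  have r3 := qNum_succ q (n + 2)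
  have r4 := qNum_succ q (n + 3)
  simp only [Nat.add_assoc, Nat.reduceAdd] at i0 i1 i2 i3 r2 r3 r4
  simp only [hc, div_eq_mul_inv, i0, i1, i2, i3, hermite, e1, e2, e4, r4, r3, r2, Nat.add_assoc,
    Nat.reduceAdd]
  ring

/-- Multiply the recurrence for the coefficients by t^{n+4} and sum; on the right 1 - (1+q)t² + q t⁴
factors. -/
theorem W_zero_mul_kernel {q t x y : ℝ} (hq : |q| < 1) (ht : |t| < 1)
    (hx : x ∈ S q) (hy : y ∈ S q) :
    W 0 x y t q * kernel q t x y 0 0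
      = (1 - t ^ 2) * (1 - t ^ 2 * q) * kernel q (t * q) x y 0 0 := by
  have htq : |t * q| < 1 := by
    rw [abs_mul]; exact mul_lt_one_of_nonneg_of_lt_one_left (abs_nonneg _) ht hq.le
  have s1 := summable_kernel hq ht hx hy
  have s2 := summable_kernel hq htq hx hy
  rw [kernel_eq_tsum, kernel_eq_tsum]
  obtain ⟨c, hc⟩ : ∃ c : ℕ → ℝ, ∀ n, c n = hermite q x n * hermite q y n / qFact q n :=
    ⟨_, fun _ => rfl⟩
  have hrec := hermite_product_recurrence hq x y c hc
  simp only [← hc] at s1 s2 ⊢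
  set F := ∑' i, c i * t ^ i with hF
  set G := ∑' i, c i * (t * q) ^ i with hG
  have f0 := s1.hasSum
  have g0 := s2.hasSum
  have sh (k : ℕ) := (hasSum_nat_add_iff' k).2 f0
  have gh (k : ℕ) := (hasSum_nat_add_iff' k).2 g0
  have key := ((((sh 4).sub ((sh 3).mul_left ((1 - q) * x * y * t))).add
    ((sh 2).mul_left ((-2 + (1 - q) * (x ^ 2 + y ^ 2)) * t ^ 2))).sub
    ((sh 1).mul_left ((1 - q) * x * y * t ^ 3))).add ((sh 0).mul_left (t ^ 4))
  have key2 := ((gh 4).sub ((gh 2).mul_left ((1 + q) * t ^ 2))).add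
    ((gh 0).mul_left (q * t ^ 4))
  have e := key.unique (key2.congr_fun fun n => by
    have := hrec n
    simp only [mul_pow]
    linear_combination t ^ (n + 4) * this)
  have c0 : c 0 = 1 := by simp [hc, hermite, qFact]
  have c1 : c 1 = x * y := by simp [hc, hermite, qFact, qNum]
  have n2 : qNum q 2 = 1 + q := by simp [qNum, Finset.sum_range_succ]
  have n3 : qNum q 3 = 1 + q + q ^ 2 := by simp [qNum, Finset.sum_range_succ]
  have n1 : qNum q 1 = 1 := by simp [qNum]
  have p2 := (qNum_pos hq 1).ne'
  have p3 := (qNum_pos hq 2).ne'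
  have c2 : (1 + q) * c 2 = (x ^ 2 - 1) * (y ^ 2 - 1) := by
    simp only [hc, hermite, qFact, Finset.prod_range_succ, Finset.prod_range_zero, n1, n2,
      zero_add, Nat.reduceAdd] at p2 ⊢
    field_simp
  have c3 : (1 + q) * ((1 + q + q ^ 2) * c 3) =
      (x * (x ^ 2 - 1) - (1 + q) * x) * (y * (y ^ 2 - 1) - (1 + q) * y) := by
    simp only [hc, hermite, qFact, Finset.prod_range_succ, Finset.prod_range_zero, n1, n2, n3,
      zero_add, Nat.reduceAdd] at p2 p3 ⊢
    field_simp
  have hq1 : 1 + q ≠ 0 := by rw [← n2]; exact p2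
  simp only [Finset.sum_range_succ, Finset.sum_range_zero, c0, c1] at e
  -- What remains are the coefficients of degree below 4: degrees 0 and 1 cancel at once, degrees 2
  -- and 3 by the values of c 2 and c 3.
  have e' : W 0 x y t q * F - (1 - t ^ 2) * (1 - t ^ 2 * q) * G
      = t ^ 2 * (1 - q) * ((1 + q) * c 2 - (x ^ 2 * y ^ 2 - x ^ 2 - y ^ 2 + 1))
        + t ^ 3 * (1 - q) * ((1 + q + q ^ 2) * c 3 - x * y * c 2
          - x * y * (3 + q - (x ^ 2 + y ^ 2))) := by
    simp only [W, pow_zero, mul_zero, mul_one]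
    linear_combination e
  have c3' : (1 + q + q ^ 2) * c 3 - x * y * c 2 - x * y * (3 + q - (x ^ 2 + y ^ 2)) = 0 := by
    apply mul_left_cancel₀ hq1
    linear_combination c3 - x * y * c2
  rw [c3', c2] at e'
  linear_combination e'

theorem W_eq (k : ℕ) (x y t q : ℝ) : W k x y t q = W 0 x y (t * q ^ k) q := by
  simp only [W]; ring

theorem abs_mul_pow_lt_one {q t : ℝ} (hq : |q| < 1) (ht : |t| < 1) (k : ℕ) :
    |t * q ^ k| < 1 := by
  rw [abs_mul, abs_pow]
  exact mul_lt_one_of_nonneg_of_lt_one_left (abs_nonneg _) ht (pow_le_one₀ (abs_nonneg _) hq.le)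

theorem prod_W_mul_kernel {q t x y : ℝ} (hq : |q| < 1) (ht : |t| < 1)
    (hx : x ∈ S q) (hy : y ∈ S q) (n : ℕ) :
    (∏ k ∈ Finset.range n, W k x y t q) * kernel q t x y 0 0
      = qPoch (t ^ 2) q (2 * n) * kernel q (t * q ^ n) x y 0 0 := by
  induction n with
  | zero => simp [qPoch]
  | succ n ih =>
    have h := W_zero_mul_kernel hq (abs_mul_pow_lt_one hq ht n) hx hy
    rw [← W_eq, mul_assoc t, ← pow_succ] at h
    rw [Finset.prod_range_succ, show 2 * (n + 1) = 2 * n + 1 + 1 by ring, qPoch_succ, qPoch_succ]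
    linear_combination W n x y t q * ih + qPoch (t ^ 2) q (2 * n) * h

/-- Since |t q^n| ≤ |t|, the series at t dominates, and only the term i = 0 survives in the limit.
-/
theorem tendsto_kernel_one {q t x y : ℝ} (hq : |q| < 1) (ht : |t| < 1)
    (hx : x ∈ S q) (hy : y ∈ S q) :
    Tendsto (fun n => kernel q (t * q ^ n) x y 0 0) atTop (𝓝 1) := by
  simp only [kernel_eq_tsum]
  have h1 : (∑' i, hermite q x i * hermite q y i / qFact q i * (0 : ℝ) ^ i) = 1 := by
    rw [tsum_eq_single 0 fun i hi => by simp [hi]]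
    simp [hermite, qFact]
  rw [← h1]
  refine tendsto_tsum_of_dominated_convergence (summable_kernel hq ht hx hy).norm (fun i => ?_)
    (Eventually.of_forall fun n i => ?_)
  · refine Tendsto.const_mul _ (Tendsto.pow ?_ _)
    simpa using (tendsto_pow_atTop_nhds_zero_of_abs_lt_one hq).const_mul t
  · rw [norm_mul, norm_mul]
    refine mul_le_mul_of_nonneg_left ?_ (norm_nonneg _)
    rw [norm_pow, norm_pow]
    refine pow_le_pow_left₀ (norm_nonneg _) ?_ _
    rw [norm_mul, norm_pow]
    exact mul_le_of_le_one_right (norm_nonneg _) (pow_le_one₀ (norm_nonneg _) hq.le)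

/-! ### Infinite products -/

theorem summable_quartic {q : ℝ} (hq : |q| < 1) (a b c d : ℝ) :
    Summable fun k : ℕ => ‖a * q ^ k + b * (q ^ k) ^ 2 + c * (q ^ k) ^ 3 + d * (q ^ k) ^ 4‖ := by
  have h (j : ℕ) (hj : j ≠ 0) : Summable fun k : ℕ => (q ^ k) ^ j := by
    simp only [pow_right_comm q _ j]
    exact summable_geometric_of_abs_lt_one (by
      rw [abs_pow]; exact pow_lt_one₀ (abs_nonneg _) hq hj)
  exact ((((summable_geometric_of_abs_lt_one hq).mul_left a).add
    ((h 2 (by simp)).mul_left b)).add ((h 3 (by simp)).mul_left c)).add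
    ((h 4 (by simp)).mul_left d) |>.norm

/-- Common to the products of W, L and 1 - a q^k: each factor is 1 plus a polynomial in q^k without
constant term, which is summable. -/
theorem multipliable_of_quartic {q : ℝ} (hq : |q| < 1) {f : ℕ → ℝ} (a b c d : ℝ)
    (hf : ∀ k, f k = 1 + (a * q ^ k + b * (q ^ k) ^ 2 + c * (q ^ k) ^ 3 + d * (q ^ k) ^ 4))
    (hf0 : ∀ k, 0 < f k) : Multipliable f ∧ 0 < ∏' k, f k := by
  obtain rfl : f = _ := funext hf
  have hs := summable_quartic hq a b c d
  have hm := multipliable_one_add_of_summable hs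
  refine ⟨hm, lt_of_le_of_ne ?_ (tprod_one_add_ne_zero_of_summable (fun k => (hf0 k).ne') hs).symm⟩
  exact ge_of_tendsto' hm.hasProd fun s => Finset.prod_nonneg fun k _ => (hf0 k).le

theorem qPoch_factor_pos {q a : ℝ} (hq : |q| < 1) (ha : |a| < 1) (k : ℕ) : 0 < 1 - a * q ^ k := by
  linarith [(abs_lt.1 (abs_mul_pow_lt_one hq ha k)).2]

theorem multipliable_qPochInf {q a : ℝ} (hq : |q| < 1) (ha : |a| < 1) :
    Multipliable (fun k : ℕ => 1 - a * q ^ k) ∧ 0 < qPochInf a q :=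
  multipliable_of_quartic hq (-a) 0 0 0 (fun k => by ring) (qPoch_factor_pos hq ha)

theorem one_add_sq_sub_pos {t c : ℝ} (ht : |t| < 1) (hc : c ^ 2 ≤ 1) :
    0 < 1 + t ^ 2 - 2 * t * c := by
  have h := abs_lt.1 ht
  have hc' := abs_le.1 (sq_le_one_iff_abs_le_one c |>.1 hc)
  rcases le_total 0 t with h0 | h0
  · nlinarith
  · nlinarith

/-- With √(1-q) x = 2 cos θ and √(1-q) y = 2 cos φ, W_0 is the product of 1 + t² - 2t cos(θ ∓ φ).
Here C, D are the cosines and E, F the sines. -/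
theorem W_zero_pos {q t x y : ℝ} (hq : |q| < 1) (ht : |t| < 1)
    (hx : x ∈ S q) (hy : y ∈ S q) : 0 < W 0 x y t q := by
  have h1 : 0 < 1 - q := by linarith [(abs_lt.1 hq).2]
  rw [mem_S_iff_sq (by linarith)] at hx hy
  set s := √(1 - q)
  have hs : s ^ 2 = 1 - q := Real.sq_sqrt h1.le
  set C := s * x / 2 with hC
  set D := s * y / 2 with hD
  have hC1 : 0 ≤ 1 - C ^ 2 := by rw [hC]; nlinarith
  have hD1 : 0 ≤ 1 - D ^ 2 := by rw [hD]; nlinarith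
  set E := √(1 - C ^ 2)
  set F := √(1 - D ^ 2)
  have hE : E ^ 2 = 1 - C ^ 2 := Real.sq_sqrt hC1
  have hF : F ^ 2 = 1 - D ^ 2 := Real.sq_sqrt hD1
  have a1 : (C * D + E * F) ^ 2 ≤ 1 := by
    have : (C * D + E * F) ^ 2 + (C * F - E * D) ^ 2 = 1 := by
      linear_combination (D ^ 2 + F ^ 2) * hE + hF
    nlinarith [sq_nonneg (C * F - E * D)]
  have a2 : (C * D - E * F) ^ 2 ≤ 1 := by
    have : (C * D - E * F) ^ 2 + (C * F + E * D) ^ 2 = 1 := by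
      linear_combination (D ^ 2 + F ^ 2) * hE + hF
    nlinarith [sq_nonneg (C * F + E * D)]
  have hW : W 0 x y t q = (1 + t ^ 2 - 2 * t * (C * D + E * F)) *
      (1 + t ^ 2 - 2 * t * (C * D - E * F)) := by
    have hxy : (1 - q) * x * y = 4 * (C * D) := by rw [hC, hD, ← hs]; ring
    have hxx : (1 - q) * (x ^ 2 + y ^ 2) = 4 * (C ^ 2 + D ^ 2) := by rw [hC, hD, ← hs]; ring
    simp only [W, mul_zero, pow_zero, mul_one]
    linear_combination (-t * (1 + t ^ 2)) * hxy + t ^ 2 * hxx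
      + 4 * t ^ 2 * F ^ 2 * hE + 4 * t ^ 2 * (1 - C ^ 2) * hF
  rw [hW]
  exact mul_pos (one_add_sq_sub_pos ht a1) (one_add_sq_sub_pos ht a2)

theorem W_pos {q t x y : ℝ} (hq : |q| < 1) (ht : |t| < 1)
    (hx : x ∈ S q) (hy : y ∈ S q) (k : ℕ) : 0 < W k x y t q := by
  rw [W_eq]
  exact W_zero_pos hq (abs_mul_pow_lt_one hq ht k) hx hy

theorem multipliable_W {q t x y : ℝ} (hq : |q| < 1) (ht : |t| < 1)
    (hx : x ∈ S q) (hy : y ∈ S q) :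
    Multipliable (fun k : ℕ => W k x y t q) ∧ 0 < ∏' k : ℕ, W k x y t q :=
  multipliable_of_quartic hq (-((1 - q) * x * y * t))
    (-2 * t ^ 2 + (1 - q) * t ^ 2 * (x ^ 2 + y ^ 2)) (-((1 - q) * x * y * t ^ 3)) (t ^ 4)
    (fun k => by simp only [W]; ring) (W_pos hq ht hx hy)

theorem L_pos {q x : ℝ} (hq : |q| < 1) (hx : |x| < 2 / √(1 - q)) (k : ℕ) : 0 < L k x q := by
  have h1 : 0 < 1 - q := by linarith [(abs_lt.1 hq).2]
  have hx2 : x ^ 2 * (1 - q) < 4 := by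
    have hs := Real.sqrt_pos.2 h1
    have h := (lt_div_iff₀ hs).1 hx
    have := Real.sq_sqrt h1.le
    have hp : 0 ≤ |x| * √(1 - q) := by positivity
    calc x ^ 2 * (1 - q) = (|x| * √(1 - q)) ^ 2 := by rw [mul_pow, sq_abs, this]
      _ < 4 := by nlinarith
  -- At k = 0 the second summand vanishes, so positivity needs x strictly inside S(q).
  have hL : 4 * L k x q = (1 + q ^ k) ^ 2 * (4 - x ^ 2 * (1 - q))
      + (1 - q ^ k) ^ 2 * (x ^ 2 * (1 - q)) := by
    simp only [L]; ring
  have hqk : 0 < 1 + q ^ k := by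
    cases k with
    | zero => simp
    | succ k =>
      have : |q ^ (k + 1)| < 1 := by
        rw [abs_pow]; exact pow_lt_one₀ (abs_nonneg _) hq (by simp)
      linarith [(abs_lt.1 this).1]
  have a1 : 0 < (1 + q ^ k) ^ 2 * (4 - x ^ 2 * (1 - q)) := mul_pos (by positivity) (by linarith)
  have a2 : 0 ≤ (1 - q ^ k) ^ 2 * (x ^ 2 * (1 - q)) := by positivity
  linarith

theorem multipliable_L {q x : ℝ} (hq : |q| < 1) (hx : |x| < 2 / √(1 - q)) :
    Multipliable (fun k : ℕ => L k x q) ∧ 0 < ∏' k : ℕ, L k x q :=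
  multipliable_of_quartic hq (2 - (1 - q) * x ^ 2) 1 0 0
    (fun k => by simp only [L]; ring) (L_pos hq hx)

theorem abs_sq_lt_one {t : ℝ} (ht : |t| < 1) : |t ^ 2| < 1 := by
  rw [abs_pow]; exact pow_lt_one₀ (abs_nonneg _) ht two_ne_zero

/-- The Poisson–Mehler formula. -/
theorem kernel_eq_div {q t x y : ℝ} (hq : |q| < 1) (ht : |t| < 1)
    (hx : x ∈ S q) (hy : y ∈ S q) :
    kernel q t x y 0 0 = qPochInf (t ^ 2) q / ∏' k : ℕ, W k x y t q := by
  obtain ⟨hm, hp⟩ := multipliable_W hq ht hx hy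
  have hP := (multipliable_qPochInf hq (abs_sq_lt_one ht)).1.hasProd.tendsto_prod_nat
  have h1 := hm.hasProd.tendsto_prod_nat.mul_const (kernel q t x y 0 0)
  have h2 := (hP.comp (tendsto_id.const_mul_atTop' two_pos)).mul
    (tendsto_kernel_one hq ht hx hy)
  rw [mul_one] at h2
  rw [eq_div_iff hp.ne', mul_comm]
  refine tendsto_nhds_unique h1 (h2.congr fun n => ?_)
  exact (prod_W_mul_kernel hq ht hx hy n).symm

/-- The density is the kernel times a factor depending only on x and q, which cancels in the ratio
of two densities. -/
theorem fCN_eq {q t x y : ℝ} (hq : |q| < 1) (ht : |t| < 1) (hx : x ∈ S q) (hy : y ∈ S q)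
    (hx' : |x| < 2 / √(1 - q)) :
    fCN x y t q = √(1 - q) * qPochInf q q / (2 * Real.pi * √(L 0 x q)) * (∏' k : ℕ, L k x q)
      * kernel q t x y 0 0 := by
  have hW := multipliable_W hq ht hx hy
  rw [fCN, (multipliable_L hq hx').1.tprod_div₀ hW.1 hW.2.ne', kernel_eq_div hq ht hx hy]
  ring

end QHermite

/-! ### The expansion of the density ratio -/

open QHermite in
theorem theorem2 (q ρ₁ ρ₂ x y z : ℝ) (hq : |q| < 1)
    (hρ₁ : |ρ₁| < 1) (hρ₁' : ρ₁ ≠ 0) (hρ₂ : |ρ₂| < 1)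
    (hx : x ∈ QHermite.S q) (hy : y ∈ QHermite.S q) (hz : z ∈ QHermite.S q) :
    Multipliable (fun k : ℕ => QHermite.W k x y ρ₂ q / QHermite.W k x z ρ₁ q) ∧
    HasSum
      (fun n : ℕ => ρ₁ ^ n / (QHermite.qFact q n * QHermite.qPoch (ρ₂ ^ 2) q n)
        * QHermite.P n x y ρ₂ q * QHermite.P n z y (ρ₂ / ρ₁) q)
      (QHermite.qPochInf (ρ₁ ^ 2) q / QHermite.qPochInf (ρ₂ ^ 2) q
        * ∏' k : ℕ, QHermite.W k x y ρ₂ q / QHermite.W k x z ρ₁ q) ∧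
    0 ≤ ∑' n : ℕ, ρ₁ ^ n / (QHermite.qFact q n * QHermite.qPoch (ρ₂ ^ 2) q n)
        * QHermite.P n x y ρ₂ q * QHermite.P n z y (ρ₂ / ρ₁) q ∧
    (|x| < 2 / √(1 - q) →
      ∑' n : ℕ, ρ₁ ^ n / (QHermite.qFact q n * QHermite.qPoch (ρ₂ ^ 2) q n)
        * QHermite.P n x y ρ₂ q * QHermite.P n z y (ρ₂ / ρ₁) q
      = QHermite.fCN x z ρ₁ q / QHermite.fCN x y ρ₂ q) := by
  obtain ⟨hm2, hp2⟩ := multipliable_W hq hρ₂ hx hy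
  obtain ⟨hm1, hp1⟩ := multipliable_W hq hρ₁ hx hz
  have hP1 := (multipliable_qPochInf hq (abs_sq_lt_one hρ₁)).2
  have hP2 := (multipliable_qPochInf hq (abs_sq_lt_one hρ₂)).2
  have hK1 := kernel_eq_div hq hρ₁ hx hz
  have hK2 := kernel_eq_div hq hρ₂ hx hy
  have hK2pos : 0 < kernel q ρ₂ x y 0 0 := hK2 ▸ div_pos hP2 hp2
  have hK1pos : 0 < kernel q ρ₁ x z 0 0 := hK1 ▸ div_pos hP1 hp1
  have hsum : HasSum (fun n : ℕ => ρ₁ ^ n / (qFact q n * qPoch (ρ₂ ^ 2) q n)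
      * P n x y ρ₂ q * P n z y (ρ₂ / ρ₁) q)
      (kernel q ρ₁ x z 0 0 / kernel q ρ₂ x y 0 0) := by
    refine ((hasSum_homP_mul_kernel hq hρ₁ hρ₁' hρ₂ hx hy hz).div_const
      (kernel q ρ₂ x y 0 0)).congr_fun fun n => ?_
    have hPn : qPoch (ρ₂ ^ 2) q n ≠ 0 :=
      Finset.prod_ne_zero_iff.2 fun k _ => (qPoch_factor_pos hq (abs_sq_lt_one hρ₂) k).ne'
    have hF := (qFact_pos hq n).ne'
    have h := qPoch_mul_kernel hq hρ₂ hx hy n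
    rw [← pow_mul_P_div q ρ₁ ρ₂ z y hρ₁']
    field_simp
    linear_combination -P n z y (ρ₂ / ρ₁) q * h
  refine ⟨hm2.div₀ hm1 hp1.ne', ?_, ?_, fun hx' => ?_⟩
  · convert hsum using 1
    rw [hm2.tprod_div₀ hm1 hp1.ne', hK1, hK2]
    field_simp
  · rw [hsum.tsum_eq]
    positivity
  · have hL0 := Real.sqrt_pos.2 (L_pos hq hx' 0)
    have hL := (multipliable_L hq hx').2
    have hqq := (multipliable_qPochInf hq hq).2
    have h1 : 0 < √(1 - q) := Real.sqrt_pos.2 (by linarith [(abs_lt.1 hq).2])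
    have hπ := Real.pi_pos
    rw [hsum.tsum_eq, fCN_eq hq hρ₁ hx hz hx', fCN_eq hq hρ₂ hx hy hx',
      mul_div_mul_left _ _ (by positivity)]
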